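/- Let $k$ be a field of characteristic zero. For a sequence $s=(s_1,\dots,s_4)$ of positive integers let $P_s\subset R=k[x_1,x_2,x_3,x_4]$ be the kernel of the $k$-algebra homomorphism $R\to k[t]$, $x_i\mapsto t^{s_i}$ (the defining ideal of the monomial curve of $s$), and let $\mu(I)$ denote the minimal number of generators of an ideal $I$. A critical binomial with respect to $x_i$ is a binomial $x_i^{\alpha}-\prod_{l\ne i}x_l^{e_l}\in P_s$ where $\alpha$ is the least positive integer such that $\alpha s_i$ lies in the semigroup $\sum_{l\neq i}\mathbb N s_l$ (with $0\in\mathbb N$). Let $a,b,c,j$ be positive integers, let $n,t,p$ be non-negative integers, and let $P_j$ be the ideal $P_s$ of the sequence $s=(j,\,a+j,\,a+b+j,\,a+b+c+j)$. Put $d=\gcd(a,b)$ and $d'=\gcd(b,c)$. (i) Let $j=(a+b+c)n$. If $c=p(a+b)$, then $$P_j=\langle x_1^{n+1}-x_4^{n},\; x_3^{p+1}-x_1^{p}x_4,\; x_2^{(a+b)/d}-x_1^{b/d}x_3^{a/d}\rangle\quad\text{and}\quad \mu(P_j)=3.$$ If $a=p(b+c)$, then $$P_j=\langle x_1^{n+1}-x_4^{n},\;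 x_2^{p+1}-x_1x_4^{p},\; x_3^{(b+c)/d'}-x_2^{c/d'}x_4^{b/d'}\rangle\quad\text{and}\quad \mu(P_j)=3.$$ (ii) Let $c=p(a+b)$, $1\le t\le p$, $j=(a+b+c)n+(a+b)t$, and suppose $n\ge 1$ and $n+t\ge p$. Then $\mu(P_j)=4$, and $P_j$ is generated by $$f_1=x_1^{n+t+1}-x_3^{t}x_4^{n},\quad f_2=x_2^{(a+b)/d}-x_1^{b/d}x_3^{a/d},\quad f_3=x_3^{p+1}-x_1^{p}x_4,\quad f_4=x_4^{n+1}-x_1^{n+t-p+1}x_3^{p-t+1},$$ where $f_i$ is a critical binomial with respect to $x_i$ for $i=1,2,3,4$. (iii) Let $a=p(b+c)$, $1\le t\le p$, $j=(a+b+c)n+(b+c)t$, and suppose $n+t>p$. Then $\mu(P_j)=4$, and $P_j$ is generated by $$f_1=x_1^{n+2}-x_2^{p+1-t}x_4^{n+t-p},\quad f_2=x_2^{p+1}-x_1x_4^{p},\quad f_3=x_3^{(b+c)/d'}-x_2^{c/d'}x_4^{b/d'},\quad f_4=x_4^{n+t}-x_1^{n+1}x_2^{t},$$ where $f_i$ is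 a critical binomial with respect to $x_i$ for $i=1,2,3,4$. -/

import Mathlib

/-- The homomorphism of `k`-algebras `φ : k[x₁, …, xₘ] → k[t]` with `xᵢ ↦ t ^ (s i)`. -/
noncomputable def monomialCurveHom (k : Type*) [Field k] {m : ℕ} (s : Fin m → ℕ) :
    MvPolynomial (Fin m) k →ₐ[k] Polynomial k :=
  MvPolynomial.aeval fun i => (Polynomial.X : Polynomial k) ^ s i

/-- The defining ideal `P_s = Ker φ` of the monomial curve attached to the sequence `s`. -/
noncomputable def definingIdeal (k : Type*) [Field k] {m : ℕ} (s : Fin m → ℕ) :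
    Ideal (MvPolynomial (Fin m) k) :=
  RingHom.ker (monomialCurveHom k s)

/-- The translated sequence `(j, a + j, a + b + j, a + b + c + j)`. -/
def translatedSeq (a b c j : ℕ) : Fin 4 → ℕ :=
  ![j, a + j, a + b + j, a + b + c + j]

/-- The minimal number of generators `μ(I)`: the least cardinality of a generating set
of the (finitely generated) ideal `I`. -/
noncomputable def minGenerators {R : Type*} [CommRing R] (I : Ideal R) : ℕ :=
  Submodule.spanFinrank I

/-- `f` is a critical binomial with respect to `xᵢ`: it lies in `P_s` and has the form
`xᵢ ^ α - ∏_{l ≠ i} x_l ^ (e l)`, where `α` is the least positive integer such that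
`α * s i` lies in the numerical semigroup (with zero) generated by the `s l`, `l ≠ i`. -/
def IsCriticalBinomial (k : Type*) [Field k] {m : ℕ} (s : Fin m → ℕ) (i : Fin m)
    (f : MvPolynomial (Fin m) k) : Prop :=
  f ∈ definingIdeal k s ∧
    ∃ (α : ℕ) (e : Fin m → ℕ),
      f = MvPolynomial.X i ^ α - ∏ l ∈ Finset.univ.erase i, MvPolynomial.X l ^ e l ∧
      IsLeast {q : ℕ | 0 < q ∧ q * s i ∈ AddSubmonoid.closure (s '' {l | l ≠ i})} α

open MvPolynomial

/-! Both claims, generation and minimality, come from monomials alone, without S-pairs. Generation: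
mark one term of each binomial and choose a weight that drops strictly when the marked term is
replaced by the other. Every monomial is then congruent, modulo the listed binomials, to a normal
one, divisible by no marked term. If distinct normal monomials have distinct degrees for `s`,
nothing more lies in the kernel (`definingIdeal_eq_of_normal_injective`). What remains is
injectivity of degrees. In the first family the degree is read off digit by digit through successive
residues (`normal_eq_of_weight_eq_left`); in the second the normal pairs fill an L-shaped
fundamental domain of a planar lattice (`normal_eq_of_weight_eq_right`). Minimality: each generator
restricts to a nonzero multiple of a pure power on its own coordinate axis and to zero on the axes
chosen for the others, so the generators are independent modulo the maximal ideal at the origin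
(`minGenerators_span_range`). The same restriction bounds critical exponents from below
(`isCriticalBinomial_of_toAxis`). -/

section General

variable {k : Type*} [Field k] {m : ℕ}

/-- The monomial `∏ xᵢ ^ eᵢ`. -/
noncomputable def expMonomial (k : Type*) [Field k] {m : ℕ} (e : Fin m → ℕ) :
    MvPolynomial (Fin m) k :=
  ∏ i, X i ^ e i

/-! ### Normal forms of monomials modulo binomials -/

lemma monomial_eq_expMonomial (e : Fin m →₀ ℕ) :
    monomial e (1 : k) = expMonomial k e := by
  rw [MvPolynomial.monomial_eq, Finsupp.prod_fintype _ _ (by simp)]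
  simp [expMonomial]

lemma expMonomial_add (e e' : Fin m → ℕ) :
    expMonomial k (e + e') = expMonomial k e * expMonomial k e' := by
  simp [expMonomial, pow_add, Finset.prod_mul_distrib]

lemma monomialCurveHom_expMonomial (s e : Fin m → ℕ) :
    monomialCurveHom k s (expMonomial k e) = Polynomial.X ^ ∑ l, e l * s l := by
  simp [monomialCurveHom, expMonomial, ← pow_mul, Finset.prod_pow_eq_pow_sum, mul_comm]

/-- Replacing a divisor `u i` by `v i` lowers the weight `w`, so rewriting terminates. -/
lemma exists_normal_congruent {ι : Type*} (I : Ideal (MvPolynomial (Fin m) k))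
    (u v : ι → Fin m → ℕ) (w : Fin m → ℕ)
    (hI : ∀ i, expMonomial k (u i) - expMonomial k (v i) ∈ I)
    (hw : ∀ i, ∑ l, v i l * w l < ∑ l, u i l * w l) (e : Fin m → ℕ) :
    ∃ e', (∀ i, ¬ u i ≤ e') ∧ expMonomial k e - expMonomial k e' ∈ I := by
  induction h : ∑ l, e l * w l using Nat.strong_induction_on generalizing e with
  | _ N ih =>
    by_cases hn : ∀ i, ¬ u i ≤ e
    · exact ⟨e, hn, by simp⟩
    · push Not at hn
      obtain ⟨i, hi⟩ := hn
      obtain ⟨r, rfl⟩ := exists_add_of_le hi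
      have hlt : ∑ l, (v i + r) l * w l < N := by
        rw [← h]
        simp only [Pi.add_apply, add_mul, Finset.sum_add_distrib]
        exact Nat.add_lt_add_right (hw i) _
      obtain ⟨e', he', hmem⟩ := ih _ hlt (v i + r) rfl
      refine ⟨e', he', ?_⟩
      have := I.add_mem (I.mul_mem_right (expMonomial k r) (hI i)) hmem
      rw [expMonomial_add] at this ⊢
      convert this using 1
      ring

/-- An ideal of binomials inside `P_s` whose normal forms have distinct weights is `P_s`. -/
theorem definingIdeal_eq_of_normal_injective {ι : Type*} (s : Fin m → ℕ)
    (I : Ideal (MvPolynomial (Fin m) k)) (hle : I ≤ definingIdeal k s)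
    (u v : ι → Fin m → ℕ) (w : Fin m → ℕ)
    (hI : ∀ i, expMonomial k (u i) - expMonomial k (v i) ∈ I)
    (hw : ∀ i, ∑ l, v i l * w l < ∑ l, u i l * w l)
    (hinj : ∀ e e' : Fin m → ℕ, (∀ i, ¬ u i ≤ e) → (∀ i, ¬ u i ≤ e') →
      ∑ l, e l * s l = ∑ l, e' l * s l → e = e') :
    definingIdeal k s = I := by
  classical
  refine le_antisymm (fun f hf => ?_) hle
  let lift : ℕ → MvPolynomial (Fin m) k := fun N =>
    if h : ∃ e : Fin m → ℕ, (∀ i, ¬ u i ≤ e) ∧ ∑ l, e l * s l = N then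
      expMonomial k h.choose else 0
  -- A linear section sending each attained power to its unique normal monomial; the default 0 is
  -- never used. Modulo `I` it inverts the curve map, so the kernel vanishes there.
  let ψ : Polynomial k →ₗ[k] MvPolynomial (Fin m) k :=
    (Polynomial.basisMonomials k).constr k lift
  have hψ : ∀ N, ψ (Polynomial.X ^ N) = lift N := fun N => by
    have := (Polynomial.basisMonomials k).constr_basis k lift N
    simpa [ψ, Polynomial.X_pow_eq_monomial] using this
  have hlift : ∀ e : Fin m → ℕ, (∀ i, ¬ u i ≤ e) →
      lift (∑ l, e l * s l) = expMonomial k e := fun e he => by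
    have h : ∃ e' : Fin m → ℕ, (∀ i, ¬ u i ≤ e') ∧ ∑ l, e' l * s l = ∑ l, e l * s l :=
      ⟨e, he, rfl⟩
    simp only [lift, dif_pos h]
    rw [hinj _ e h.choose_spec.1 he h.choose_spec.2]
  have key : (Ideal.Quotient.mkₐ k I).toLinearMap ∘ₗ ψ ∘ₗ (monomialCurveHom k s).toLinearMap =
      (Ideal.Quotient.mkₐ k I).toLinearMap := by
    refine (MvPolynomial.basisMonomials (Fin m) k).ext fun e => ?_
    obtain ⟨e', he', hmem⟩ := exists_normal_congruent I u v w hI hw e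
    have h1 : monomialCurveHom k s (expMonomial k e) =
        monomialCurveHom k s (expMonomial k e') := by
      have := hle hmem
      rw [definingIdeal, RingHom.mem_ker, map_sub, sub_eq_zero] at this
      exact this
    simp only [coe_basisMonomials, monomial_eq_expMonomial, LinearMap.comp_apply,
      AlgHom.toLinearMap_apply, h1]
    rw [monomialCurveHom_expMonomial, hψ, hlift _ he']
    exact (Ideal.Quotient.eq.2 hmem).symm
  have hf0 : monomialCurveHom k s f = 0 := hf
  have := LinearMap.congr_fun key f
  simp only [LinearMap.comp_apply, AlgHom.toLinearMap_apply, hf0, map_zero] at this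
  exact Ideal.Quotient.eq_zero_iff_mem.1 this.symm

/-- The two signs in `hf` allow the marked term to be either term of the generator: in every family
the first generator is marked at its second term. -/
theorem definingIdeal_eq_span_range {ι : Type*} (s : Fin m → ℕ)
    (f : ι → MvPolynomial (Fin m) k) (u v : ι → Fin m → ℕ) (w : Fin m → ℕ)
    (hf : ∀ i, f i = expMonomial k (u i) - expMonomial k (v i) ∨
      f i = expMonomial k (v i) - expMonomial k (u i))
    (hs : ∀ i, ∑ l, u i l * s l = ∑ l, v i l * s l)
    (hw : ∀ i, ∑ l, v i l * w l < ∑ l, u i l * w l)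
    (hinj : ∀ e e' : Fin m → ℕ, (∀ i, ¬ u i ≤ e) → (∀ i, ¬ u i ≤ e') →
      ∑ l, e l * s l = ∑ l, e' l * s l → e = e') :
    definingIdeal k s = Ideal.span (Set.range f) := by
  refine definingIdeal_eq_of_normal_injective s _ ?_ u v w (fun i => ?_) hw hinj
  · rw [Ideal.span_le]
    rintro _ ⟨i, rfl⟩
    rw [SetLike.mem_coe, definingIdeal, RingHom.mem_ker]
    rcases hf i with h | h <;>
      rw [h, map_sub, monomialCurveHom_expMonomial, monomialCurveHom_expMonomial, hs, sub_self]
  · have hi : f i ∈ Ideal.span (Set.range f) := Ideal.subset_span ⟨i, rfl⟩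
    rcases hf i with h | h
    · rwa [← h]
    · rw [← neg_sub, ← h]
      exact neg_mem hi

/-! ### Restriction to axes: minimality and criticality -/

/-- Restriction to the `i`-th coordinate axis: all variables but `xᵢ` are set to zero. -/
noncomputable def toAxis (k : Type*) [Field k] {m : ℕ} (i : Fin m) :
    MvPolynomial (Fin m) k →ₐ[k] Polynomial k :=
  aeval (Pi.single i Polynomial.X)

lemma toAxis_X (i l : Fin m) :
    toAxis k i (X l) = if l = i then Polynomial.X else 0 := by
  simp [toAxis, Pi.single_apply]

lemma coeff_zero_toAxis (i : Fin m) (g : MvPolynomial (Fin m) k) :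
    (toAxis k i g).coeff 0 = constantCoeff g := by
  have : (Polynomial.constantCoeff.comp (toAxis k i).toRingHom) =
      (constantCoeff : MvPolynomial (Fin m) k →+* k) := by
    apply MvPolynomial.ringHom_ext
    · intro r
      simp [toAxis]
    · intro l
      by_cases h : l = i <;> simp [toAxis_X, h]
  simpa using RingHom.congr_fun this g

lemma toAxis_mem_span {ι : Type*} (f : ι → MvPolynomial (Fin m) k) (i : Fin m) (α : ℕ)
    (h : ∀ l, Polynomial.X ^ α ∣ toAxis k i (f l)) {g : MvPolynomial (Fin m) k}
    (hg : g ∈ Ideal.span (Set.range f)) : Polynomial.X ^ α ∣ toAxis k i g := by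
  have : Ideal.span (Set.range f) ≤
      (Ideal.span {(Polynomial.X : Polynomial k) ^ α}).comap (toAxis k i) := by
    rw [Ideal.span_le]
    rintro _ ⟨l, rfl⟩
    exact Ideal.mem_span_singleton.2 (h l)
  exact Ideal.mem_span_singleton.1 (this hg)

/-- If the generators restrict to independent pure powers on distinct axes, no smaller
generating set exists. -/
theorem minGenerators_span_range {ι : Type*} [Fintype ι] [DecidableEq ι]
    (f : ι → MvPolynomial (Fin m) k) (x : ι → Fin m) (α : ι → ℕ) (c : ι → k)
    (hc : ∀ i, c i ≠ 0)
    (h : ∀ i l, toAxis k (x i) (f l) =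
      if l = i then Polynomial.C (c i) * Polynomial.X ^ α i else 0) :
    minGenerators (Ideal.span (Set.range f)) = Fintype.card ι := by
  classical
  set I := Ideal.span (Set.range f) with hIdef
  have hfg : I.FG := ⟨Finset.univ.image f, by simp [hIdef]⟩
  refine le_antisymm ?_ ?_
  · calc minGenerators I ≤ (Set.range f).ncard :=
          Submodule.spanFinrank_span_le_ncard_of_finite (Set.finite_range f)
      _ ≤ Fintype.card ι := by
          rw [← Set.image_univ, ← Nat.card_eq_fintype_card, ← Set.ncard_univ]
          exact Set.ncard_image_le Set.finite_univ
  · let γ : MvPolynomial (Fin m) k →ₗ[k] (ι → k) :=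
      LinearMap.pi fun i => Polynomial.lcoeff k (α i) ∘ₗ (toAxis k (x i)).toLinearMap
    have hγ : ∀ g i, γ g i = (toAxis k (x i) g).coeff (α i) := fun _ _ => rfl
    have hdvd : ∀ g ∈ I, ∀ i, Polynomial.X ^ α i ∣ toAxis k (x i) g := fun g hg i => by
      refine toAxis_mem_span f (x i) (α i) (fun l => ?_) hg
      rw [h]
      split_ifs <;> simp
    -- Elements of `I` vanish to order `α i` on the axis, so only the constant term of `r` reaches
    -- this coefficient: `γ` kills the maximal ideal times `I`.
    have hmul : ∀ r, ∀ g ∈ I, γ (r * g) = constantCoeff r • γ g := fun r g hg => by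
      ext i
      obtain ⟨q, hq⟩ := hdvd g hg i
      simp only [hγ, map_mul, hq, Pi.smul_apply, smul_eq_mul]
      rw [mul_left_comm]
      simp [Polynomial.coeff_X_pow_mul', Polynomial.mul_coeff_zero, coeff_zero_toAxis]
    set S := Submodule.generators I
    have hspan : Submodule.span (MvPolynomial (Fin m) k) S = I := Submodule.span_generators I
    have hSI : S ⊆ I := fun g hg => by
      rw [← hspan]
      exact Submodule.subset_span hg
    have hfin : S.Finite := Submodule.FG.finite_generators hfg
    have hmem : ∀ g ∈ I, g ∈ I ∧ γ g ∈ Submodule.span k (γ '' S) := fun g hg => by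
      rw [← hspan] at hg
      induction hg using Submodule.span_induction with
      | mem g hg => exact ⟨hSI hg, Submodule.subset_span ⟨g, hg, rfl⟩⟩
      | zero => simp
      | add g g' _ _ ih ih' =>
        refine ⟨I.add_mem ih.1 ih'.1, ?_⟩
        rw [map_add]
        exact Submodule.add_mem _ ih.2 ih'.2
      | smul r g _ ih =>
        refine ⟨I.mul_mem_left r ih.1, ?_⟩
        rw [smul_eq_mul, hmul r g ih.1]
        exact Submodule.smul_mem _ _ ih.2
    have htop : Submodule.span k (γ '' S) = ⊤ := by
      rw [eq_top_iff, ← (Pi.basisFun k ι).span_eq, Submodule.span_le]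
      rintro _ ⟨i, rfl⟩
      have hi := (hmem (f i) (Ideal.subset_span ⟨i, rfl⟩)).2
      have hfi : γ (f i) = c i • (Pi.basisFun k ι) i := by
        ext l
        rw [hγ, h]
        by_cases hl : i = l
        · subst hl; simp
        · simp [hl, Ne.symm hl]
      have := Submodule.smul_mem _ (c i)⁻¹ hi
      rwa [hfi, smul_smul, inv_mul_cancel₀ (hc i), one_smul] at this
    calc Fintype.card ι = Module.finrank k (ι → k) := by simp
      _ = Module.finrank k (Submodule.span k (γ '' S)) := by rw [htop, finrank_top]
      _ ≤ (γ '' S).ncard := by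
          have := (hfin.image γ).fintype
          rw [Set.ncard_eq_toFinset_card']
          exact finrank_span_le_card _
      _ ≤ S.ncard := Set.ncard_image_le hfin
      _ = minGenerators I := Submodule.FG.generators_ncard hfg

/-- The witness is a monomial in the variables other than `X i`; for `N = 0` it is 1, which does not
vanish on the axis. -/
lemma exists_curveHom_eq_X_pow (s : Fin m → ℕ) (i : Fin m) {N : ℕ}
    (hN : N ∈ AddSubmonoid.closure (s '' {l | l ≠ i})) :
    ∃ g, monomialCurveHom k s g = Polynomial.X ^ N ∧ (0 < N → toAxis k i g = 0) := by
  induction hN using AddSubmonoid.closure_induction with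
  | mem N hN =>
    obtain ⟨l, hl, rfl⟩ := hN
    exact ⟨X l, by simp [monomialCurveHom], fun _ => by simp [toAxis_X, show l ≠ i from hl]⟩
  | zero => exact ⟨1, by simp⟩
  | add N N' _ _ ih ih' =>
    obtain ⟨g, hg, h0⟩ := ih
    obtain ⟨g', hg', h0'⟩ := ih'
    refine ⟨g * g', by rw [map_mul, hg, hg', pow_add], fun hpos => ?_⟩
    rw [map_mul]
    rcases Nat.eq_zero_or_pos N with h | h
    · rw [h0' (by omega), mul_zero]
    · rw [h0 h, zero_mul]

/-- A smaller multiple of `s i` in the semigroup would put some `X i ^ q - g` in the ideal with `g`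
zero on the axis, yet everything in the ideal is divisible there by the power `α`. -/
theorem isCriticalBinomial_of_toAxis {ι : Type*} (s : Fin m → ℕ) (i : Fin m) (hsi : 0 < s i)
    (f : ι → MvPolynomial (Fin m) k) (hP : definingIdeal k s = Ideal.span (Set.range f))
    (α : ℕ) (hα : 0 < α) (h : ∀ l, Polynomial.X ^ α ∣ toAxis k i (f l)) (l : ι)
    (e : Fin m → ℕ) (hl : f l = X i ^ α - ∏ l ∈ Finset.univ.erase i, X l ^ e l) :
    IsCriticalBinomial k s i (f l) := by
  have hmem : f l ∈ definingIdeal k s := by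
    rw [hP]
    exact Ideal.subset_span ⟨l, rfl⟩
  refine ⟨hmem, α, e, hl, ⟨hα, ?_⟩, fun q hq => ?_⟩
  · have hw : α * s i = ∑ l ∈ Finset.univ.erase i, e l * s l := by
      have := hmem
      rw [hl, definingIdeal, RingHom.mem_ker, map_sub, sub_eq_zero] at this
      simp only [monomialCurveHom, map_pow, map_prod, aeval_X, ← pow_mul,
        Finset.prod_pow_eq_pow_sum] at this
      have := congrArg Polynomial.natDegree this
      simpa [mul_comm] using this
    rw [hw]
    refine sum_mem fun l hl => ?_
    rw [← smul_eq_mul]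
    exact AddSubmonoid.nsmul_mem _
      (AddSubmonoid.subset_closure (Set.mem_image_of_mem s (Finset.ne_of_mem_erase hl))) _
  · obtain ⟨g, hg, h0⟩ := exists_curveHom_eq_X_pow (k := k) s i hq.2
    have hq' : X i ^ q - g ∈ Ideal.span (Set.range f) := by
      rw [← hP, definingIdeal, RingHom.mem_ker, map_sub, hg, sub_eq_zero]
      simp [monomialCurveHom, ← pow_mul, mul_comm]
    have := toAxis_mem_span f i α h hq'
    rw [map_sub, h0 (Nat.mul_pos hq.1 hsi), sub_zero, map_pow, toAxis_X, if_pos rfl] at this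
    exact (pow_dvd_pow_iff Polynomial.X_ne_zero Polynomial.not_isUnit_X).1 this

end General

/-! ### Injectivity of degrees on normal exponents -/

section Arithmetic

lemma residue_eq_of_coprime {A D x x' N N' : ℕ} (hco : A.Coprime D) (hx : x < D) (hx' : x' < D)
    (h : x * A + D * N = x' * A + D * N') : x = x' := by
  have hmod : x * A ≡ x' * A [MOD D] := by
    have := congrArg (· % D) h
    simpa [Nat.ModEq] using this
  have := Nat.ModEq.cancel_right_of_coprime (by rwa [Nat.coprime_comm] at hco) hmod
  exact Nat.ModEq.eq_of_lt_of_lt this hx hx'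

/-- Read `x`, `y` as base `p + 1` digits; the excluded corner holds exactly the codes from `(p + 1)
* n + t` upwards. -/
lemma code_lt {p n t x y : ℕ} (hx : x ≤ p) (hy : y ≤ n)
    (hxy : ¬ (t ≤ x ∧ n ≤ y)) : x + (p + 1) * y < (p + 1) * n + t := by
  rcases hy.lt_or_eq with h | rfl
  · have := Nat.mul_le_mul_left (p + 1) (Nat.succ_le_of_lt h)
    rw [Nat.mul_succ] at this
    omega
  · have : x < t := by
      by_contra hlt
      exact hxy ⟨by omega, le_refl _⟩
    omega

/-- With `D = A + B` and `M = (p + 1) * n + t`, the residue mod `D` gives `e 1`; after division by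
`D`, the residue mod `M` gives the code `e 2 + (p + 1) * e 3`, whose digits are `e 2` and `e 3`; the
quotient gives `e 0`. -/
lemma normal_eq_of_weight_eq_left {A B p n t : ℕ} (hco : A.Coprime B) (hD : 0 < A + B)
    (hM : 0 < (p + 1) * n + t) {e e' : Fin 4 → ℕ}
    (h1 : e 1 < A + B) (h1' : e' 1 < A + B) (h2 : e 2 ≤ p) (h2' : e' 2 ≤ p)
    (h3 : e 3 ≤ n) (h3' : e' 3 ≤ n) (h23 : ¬ (t ≤ e 2 ∧ n ≤ e 3))
    (h23' : ¬ (t ≤ e' 2 ∧ n ≤ e' 3))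
    (h : ∑ l, e l * ![(A + B) * ((p + 1) * n + t), A + (A + B) * ((p + 1) * n + t),
        (A + B) + (A + B) * ((p + 1) * n + t),
        (p + 1) * (A + B) + (A + B) * ((p + 1) * n + t)] l =
      ∑ l, e' l * ![(A + B) * ((p + 1) * n + t), A + (A + B) * ((p + 1) * n + t),
        (A + B) + (A + B) * ((p + 1) * n + t),
        (p + 1) * (A + B) + (A + B) * ((p + 1) * n + t)] l) : e = e' := by
  have hc := code_lt h2 h3 h23
  have hc' := code_lt h2' h3' h23'
  generalize (p + 1) * n + t = M at *
  have hcoD : A.Coprime (A + B) := by simpa using hco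
  generalize A + B = D at *
  simp only [Fin.sum_univ_four, Matrix.cons_val] at h
  have e1 : e 1 = e' 1 := by
    refine residue_eq_of_coprime (N := (e 0 + e 1 + e 2 + e 3) * M + e 2 + (p + 1) * e 3)
      (N' := (e' 0 + e' 1 + e' 2 + e' 3) * M + e' 2 + (p + 1) * e' 3) hcoD h1 h1' ?_
    linear_combination h
  have hq : (e 0 + e 1 + e 2 + e 3) * M + (e 2 + (p + 1) * e 3) =
      (e' 0 + e' 1 + e' 2 + e' 3) * M + (e' 2 + (p + 1) * e' 3) := by
    refine Nat.eq_of_mul_eq_mul_left hD ?_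
    rw [e1] at h ⊢
    linarith
  have hcode : e 2 + (p + 1) * e 3 = e' 2 + (p + 1) * e' 3 :=
    residue_eq_of_coprime (A := 1) (N := e 0 + e 1 + e 2 + e 3)
      (N' := e' 0 + e' 1 + e' 2 + e' 3) (by simp) hc hc' (by linarith)
  have e2 : e 2 = e' 2 :=
    residue_eq_of_coprime (A := 1) (D := p + 1) (by simp) (by omega) (by omega)
      (by simpa using hcode)
  have e3 : e 3 = e' 3 := by
    rw [e2] at hcode
    exact Nat.eq_of_mul_eq_mul_left p.add_one_pos (by omega)
  have e0 : e 0 = e' 0 := by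
    rw [hcode] at hq
    have := Nat.eq_of_mul_eq_mul_right hM (Nat.add_right_cancel hq)
    omega
  ext l
  fin_cases l <;> assumption

/-- The lattice spanned by `(p + 1, -p)` and `(-t, n + t)` has determinant `(p + 1) * n + t`, the
area of the L-shape left when a `t` by `p` corner is cut from a `p + 1` by `n + t` rectangle. No
nonzero lattice vector joins two of its points. -/
lemma pair_eq_of_lattice {p n t x y x' y' : ℤ} (ht : 0 < t) (htp : t ≤ p) (hn : p < n + t)
    (hx : 0 ≤ x ∧ x ≤ p) (hx' : 0 ≤ x' ∧ x' ≤ p) (hy : 0 ≤ y ∧ y < n + t)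
    (hy' : 0 ≤ y' ∧ y' < n + t) (hxy : x < p + 1 - t ∨ y < n + t - p)
    (hxy' : x' < p + 1 - t ∨ y' < n + t - p) (i j : ℤ)
    (h1 : x - x' = i * (p + 1) - j * t) (h2 : y - y' = j * (n + t) - i * p) :
    i = 0 ∧ j = 0 := by
  have main : ∀ {x y x' y' : ℤ}, (0 ≤ x ∧ x ≤ p) → (0 ≤ x' ∧ x' ≤ p) → (0 ≤ y ∧ y < n + t) →
      (0 ≤ y' ∧ y' < n + t) → (x < p + 1 - t ∨ y < n + t - p) → ∀ i j : ℤ,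
      x - x' = i * (p + 1) - j * t → y - y' = j * (n + t) - i * p → i ≤ 0 ∧ j ≤ 0 := by
    intro x y x' y' hx hx' hy hy' hxy i j h1 h2
    by_contra hcon
    -- If `i < j` the second coordinate moves by at least `n + t`; if `i > j` the first moves by at
    -- least `p + 1`; if they are equal, `(x, y)` is forced into the removed corner.
    rcases lt_trichotomy i j with hij | rfl | hij
    · have hj : 0 < j := by omega
      rcases le_or_gt i 0 with hi | hi
      · nlinarith
      · nlinarith
    · have hi : 0 < i := by omega
      rcases hxy with h | h <;> nlinarith
    · have hi : 0 < i := by omega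
      rcases le_or_gt j 0 with hj | hj
      · nlinarith
      · nlinarith
  have h := main hx hx' hy hy' hxy i j h1 h2
  have h' := main hx' hx hy' hy hxy' (-i) (-j) (by linarith) (by linarith)
  omega

/-- The residue mod `B + C` gives `e 2`. What is left fixes `p * e 1 + (p + 1) * e 3` mod `M`, and
the differences of such pairs form the lattice of `pair_eq_of_lattice`. For `t = 0` the L-shape is a
rectangle, and residues mod `p + 1` and mod `n` suffice. -/
lemma normal_eq_of_weight_eq_right {B C p n t : ℕ} (hco : B.Coprime C) (hD : 0 < B + C)
    (htp : t ≤ p) (hn : 0 < t ∧ p < n + t ∨ t = 0 ∧ 0 < n) {e e' : Fin 4 → ℕ}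
    (h1 : e 1 ≤ p) (h1' : e' 1 ≤ p) (h2 : e 2 < B + C) (h2' : e' 2 < B + C)
    (h3 : e 3 < n + t) (h3' : e' 3 < n + t) (h13 : ¬ (p + 1 - t ≤ e 1 ∧ n + t - p ≤ e 3))
    (h13' : ¬ (p + 1 - t ≤ e' 1 ∧ n + t - p ≤ e' 3))
    (h : ∑ l, e l * ![(B + C) * ((p + 1) * n + t), p * (B + C) + (B + C) * ((p + 1) * n + t),
        p * (B + C) + B + (B + C) * ((p + 1) * n + t),
        (p + 1) * (B + C) + (B + C) * ((p + 1) * n + t)] l =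
      ∑ l, e' l * ![(B + C) * ((p + 1) * n + t), p * (B + C) + (B + C) * ((p + 1) * n + t),
        p * (B + C) + B + (B + C) * ((p + 1) * n + t),
        (p + 1) * (B + C) + (B + C) * ((p + 1) * n + t)] l) : e = e' := by
  have hcoD : B.Coprime (B + C) := by simpa using hco
  have hM : 0 < (p + 1) * n + t := by
    rcases hn with h | h
    · omega
    · have : 0 < (p + 1) * n := Nat.mul_pos p.add_one_pos h.2
      omega
  obtain ⟨M, hMdef⟩ : ∃ M, M = (p + 1) * n + t := ⟨_, rfl⟩
  rw [← hMdef] at h hM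
  generalize B + C = D at *
  simp only [Fin.sum_univ_four, Matrix.cons_val] at h
  have e2 : e 2 = e' 2 := by
    refine residue_eq_of_coprime
      (N := (e 0 + e 1 + e 2 + e 3) * M + p * e 1 + p * e 2 + (p + 1) * e 3)
      (N' := (e' 0 + e' 1 + e' 2 + e' 3) * M + p * e' 1 + p * e' 2 + (p + 1) * e' 3)
      hcoD h2 h2' ?_
    linear_combination h
  have hq : (e 0 + e 1 + e 3) * M + p * e 1 + (p + 1) * e 3 =
      (e' 0 + e' 1 + e' 3) * M + p * e' 1 + (p + 1) * e' 3 := by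
    refine Nat.eq_of_mul_eq_mul_left hD ?_
    rw [e2] at h
    linarith
  have e13 : e 1 = e' 1 ∧ e 3 = e' 3 := by
    rcases hn with hn | ⟨rfl, hn⟩
    · zify at hq hMdef
      have := pair_eq_of_lattice (p := p) (n := n) (t := t) (x := e 1) (y := e 3) (x' := e' 1)
        (y' := e' 3) (by omega) (by omega) (by omega) (by omega) (by omega) (by omega) (by omega)
        (by omega) (by omega)
        -- Lattice coordinates obtained by solving `hq` for the difference in the basis `(p + 1,
        -- -p)`, `(-t, n + t)`.
        ((e 1 + e 3 - e' 1 - e' 3) + n * (e 0 + e 1 + e 3 - e' 0 - e' 1 - e' 3))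
        (-(e 0 + e 1 + e 3 - e' 0 - e' 1 - e' 3))
        (by rw [hMdef] at hq; linear_combination -hq)
        (by rw [hMdef] at hq; linear_combination hq)
      obtain ⟨hi, hj⟩ := this
      have hj' : (e 0 + e 1 + e 3 - e' 0 - e' 1 - e' 3 : ℤ) = 0 := by linarith
      rw [hj', mul_zero, add_zero] at hi
      have hz : (e 1 : ℤ) = e' 1 := by linear_combination -hq + hj' * M + (p + 1) * hi
      omega
    · have e1 : e 1 = e' 1 := by
        have hcop : p.Coprime (p + 1) := by simp
        refine residue_eq_of_coprime (N := (e 0 + e 1 + e 3) * n + e 3)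
          (N' := (e' 0 + e' 1 + e' 3) * n + e' 3) hcop (Nat.lt_succ_of_le h1)
          (Nat.lt_succ_of_le h1') ?_
        rw [hMdef] at hq
        linear_combination hq
      refine ⟨e1, residue_eq_of_coprime (A := 1) (D := n) (N := e 0 + e 1 + e 3)
        (N' := e' 0 + e' 1 + e' 3) (by simp) (by omega) (by omega) ?_⟩
      refine Nat.eq_of_mul_eq_mul_left p.add_one_pos ?_
      rw [hMdef, e1] at hq
      rw [e1]
      linear_combination hq
  have e0 : e 0 = e' 0 := by
    rw [e13.1, e13.2] at hq
    have : (e 0 + e' 1 + e' 3) * M = (e' 0 + e' 1 + e' 3) * M := by omega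
    have := Nat.eq_of_mul_eq_mul_right hM this
    omega
  obtain ⟨e1, e3⟩ := e13
  ext l
  fin_cases l <;> assumption

end Arithmetic

/-! ### Generators of the four families -/

section Curves

variable {k : Type*} [Field k]

/-- The gcd `d` divides all four terms of the sequence, so it cancels from every equality of
degrees. -/
lemma exists_coprime_parts {a b : ℕ} (ha : 0 < a) (hb : 0 < b) :
    ∃ A B d, 0 < A ∧ 0 < B ∧ 0 < d ∧ A.Coprime B ∧ a = d * A ∧ b = d * B ∧
      a / a.gcd b = A ∧ b / a.gcd b = B ∧ (a + b) / a.gcd b = A + B := by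
  have hd : 0 < a.gcd b := Nat.gcd_pos_of_pos_left b ha
  obtain ⟨A, B, hco, hA, hB⟩ := Nat.exists_coprime a b
  generalize a.gcd b = d at *
  subst hA hB
  refine ⟨A, B, d, Nat.pos_of_mul_pos_right ha, Nat.pos_of_mul_pos_right hb, hd, hco,
    mul_comm _ _, mul_comm _ _, Nat.mul_div_cancel _ hd, Nat.mul_div_cancel _ hd, ?_⟩
  rw [← add_mul, Nat.mul_div_cancel _ hd]

lemma expMonomial_four (e : Fin 4 → ℕ) :
    expMonomial k e = X 0 ^ e 0 * X 1 ^ e 1 * X 2 ^ e 2 * X 3 ^ e 3 := by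
  simp [expMonomial, Fin.prod_univ_four]

lemma vec_le_iff {x0 x1 x2 x3 : ℕ} {e : Fin 4 → ℕ} :
    ![x0, x1, x2, x3] ≤ e ↔ x0 ≤ e 0 ∧ x1 ≤ e 1 ∧ x2 ≤ e 2 ∧ x3 ≤ e 3 := by
  simp [Pi.le_def, Fin.forall_fin_succ]

lemma definingIdeal_left_multiple {A B d p n : ℕ} (hB : 0 < B) (hd : 0 < d)
    (hco : A.Coprime B) (hp : 0 < p) (hn : 0 < n) :
    definingIdeal k (translatedSeq (d * A) (d * B) (p * (d * A + d * B))
      ((d * A + d * B + p * (d * A + d * B)) * n)) =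
      Ideal.span (Set.range ![X 0 ^ (n + 1) - X 3 ^ n, X 2 ^ (p + 1) - X 0 ^ p * X 3,
        X 1 ^ (A + B) - X 0 ^ B * X 2 ^ A]) := by
  refine definingIdeal_eq_span_range _ _
    ![![0, 0, 0, n], ![0, 0, p + 1, 0], ![0, A + B, 0, 0]]
    ![![n + 1, 0, 0, 0], ![p, 0, 0, 1], ![B, 0, A, 0]] ![0, 1, 1, 1] ?_ ?_ ?_ ?_
  · intro i
    fin_cases i <;> simp [expMonomial_four]
  · intro i
    fin_cases i <;> simp [Fin.sum_univ_four, translatedSeq] <;> ring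
  · intro i
    fin_cases i <;> simp [Fin.sum_univ_four] <;> omega
  · intro e e' he he' h
    simp [Fin.forall_fin_succ, vec_le_iff] at he he'
    refine normal_eq_of_weight_eq_left (t := 0) (p := p) (n := n) hco (by omega)
      (by positivity) he.2.2 he'.2.2 (by omega) (by omega) he.1.le he'.1.le (by omega) (by omega) ?_
    refine Nat.eq_of_mul_eq_mul_left hd ?_
    simp only [Fin.sum_univ_four, translatedSeq, Matrix.cons_val] at h ⊢
    linear_combination h

lemma definingIdeal_left_shift {A B d p n t : ℕ} (hB : 0 < B) (hd : 0 < d)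
    (hco : A.Coprime B) (hp : 0 < p) (hn : 0 < n) (ht : 0 < t) (htp : t ≤ p) (hpn : p ≤ n + t) :
    definingIdeal k (translatedSeq (d * A) (d * B) (p * (d * A + d * B))
      ((d * A + d * B + p * (d * A + d * B)) * n + (d * A + d * B) * t)) =
      Ideal.span (Set.range ![X 0 ^ (n + t + 1) - X 2 ^ t * X 3 ^ n,
        X 1 ^ (A + B) - X 0 ^ B * X 2 ^ A, X 2 ^ (p + 1) - X 0 ^ p * X 3,
        X 3 ^ (n + 1) - X 0 ^ (n + t - p + 1) * X 2 ^ (p - t + 1)]) := by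
  refine definingIdeal_eq_span_range _ _
    ![![0, 0, t, n], ![0, A + B, 0, 0], ![0, 0, p + 1, 0], ![0, 0, 0, n + 1]]
    ![![n + t + 1, 0, 0, 0], ![B, 0, A, 0], ![p, 0, 0, 1], ![n + t - p + 1, 0, p - t + 1, 0]]
    ![0, 1, 1, p] ?_ ?_ ?_ ?_
  · intro i
    fin_cases i <;> simp [expMonomial_four]
  · obtain ⟨q, rfl⟩ := Nat.exists_eq_add_of_le htp
    obtain ⟨r, hr⟩ := Nat.exists_eq_add_of_le hpn
    have hnr : n = q + r := by omega
    subst hnr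
    rw [show q + r + t - (t + q) = r by omega, show t + q - t = q by omega]
    intro i
    fin_cases i <;> simp [Fin.sum_univ_four, translatedSeq] <;> ring
  -- Weight `p` on the last variable makes `X 3 ^ (n + 1)` outweigh `X 2 ^ (p - t + 1)`, while `X 0
  -- ^ p * X 3` stays below `X 2 ^ (p + 1)`.
  · have hnp : p ≤ n * p := Nat.le_mul_of_pos_left p hn
    intro i
    fin_cases i <;> simp [Fin.sum_univ_four, add_mul] <;> omega
  · intro e e' he he' h
    simp [Fin.forall_fin_succ, vec_le_iff] at he he'
    refine normal_eq_of_weight_eq_left (t := t) (p := p) (n := n) hco (by omega)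
      (by positivity) he.2.1 he'.2.1 (by omega) (by omega) (by omega) (by omega) (by omega)
      (by omega) ?_
    refine Nat.eq_of_mul_eq_mul_left hd ?_
    simp only [Fin.sum_univ_four, translatedSeq, Matrix.cons_val] at h ⊢
    linear_combination h

lemma definingIdeal_right_multiple {B C d p n : ℕ} (hB : 0 < B) (hC : 0 < C) (hd : 0 < d)
    (hco : B.Coprime C) (hp : 0 < p) (hn : 0 < n) :
    definingIdeal k (translatedSeq (p * (d * B + d * C)) (d * B) (d * C)
      ((p * (d * B + d * C) + d * B + d * C) * n)) =
      Ideal.span (Set.range ![X 0 ^ (n + 1) - X 3 ^ n, X 1 ^ (p + 1) - X 0 * X 3 ^ p,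
        X 2 ^ (B + C) - X 1 ^ C * X 3 ^ B]) := by
  refine definingIdeal_eq_span_range _ _
    ![![0, 0, 0, n], ![0, p + 1, 0, 0], ![0, 0, B + C, 0]]
    ![![n + 1, 0, 0, 0], ![1, 0, 0, p], ![0, C, 0, B]] ![0, 1, 2, 1] ?_ ?_ ?_ ?_
  · intro i
    fin_cases i <;> simp [expMonomial_four]
  · intro i
    fin_cases i <;> simp [Fin.sum_univ_four, translatedSeq] <;> ring
  · intro i
    fin_cases i <;> simp [Fin.sum_univ_four] <;> omega
  · intro e e' he he' h
    simp [Fin.forall_fin_succ, vec_le_iff] at he he'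
    refine normal_eq_of_weight_eq_right (t := 0) (p := p) (n := n) hco (by omega)
      (by omega) (by omega) (by omega) (by omega) he.2.2 he'.2.2 he.1 he'.1 (by omega)
      (by omega) ?_
    refine Nat.eq_of_mul_eq_mul_left hd ?_
    simp only [Fin.sum_univ_four, translatedSeq, Matrix.cons_val] at h ⊢
    linear_combination h

lemma definingIdeal_right_shift {B C d p n t : ℕ} (hB : 0 < B) (hC : 0 < C) (hd : 0 < d)
    (hco : B.Coprime C) (ht : 0 < t) (htp : t ≤ p) (hpn : p < n + t) :
    definingIdeal k (translatedSeq (p * (d * B + d * C)) (d * B) (d * C)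
      ((p * (d * B + d * C) + d * B + d * C) * n + (d * B + d * C) * t)) =
      Ideal.span (Set.range ![X 0 ^ (n + 2) - X 1 ^ (p + 1 - t) * X 3 ^ (n + t - p),
        X 1 ^ (p + 1) - X 0 * X 3 ^ p, X 2 ^ (B + C) - X 1 ^ C * X 3 ^ B,
        X 3 ^ (n + t) - X 0 ^ (n + 1) * X 1 ^ t]) := by
  refine definingIdeal_eq_span_range _ _
    ![![0, p + 1 - t, 0, n + t - p], ![0, p + 1, 0, 0], ![0, 0, B + C, 0], ![0, 0, 0, n + t]]
    ![![n + 2, 0, 0, 0], ![1, 0, 0, p], ![0, C, 0, B], ![n + 1, t, 0, 0]]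
    ![0, 1, 2, 1] ?_ ?_ ?_ ?_
  · intro i
    fin_cases i <;> simp [expMonomial_four]
  · obtain ⟨q, rfl⟩ := Nat.exists_eq_add_of_le htp
    obtain ⟨r, hr⟩ := Nat.exists_eq_add_of_lt hpn
    have hnr : n = q + r + 1 := by omega
    subst hnr
    rw [show q + r + 1 + t - (t + q) = r + 1 by omega, show t + q + 1 - t = q + 1 by omega]
    intro i
    fin_cases i <;> simp [Fin.sum_univ_four, translatedSeq] <;> ring
  · intro i
    fin_cases i <;> simp [Fin.sum_univ_four] <;> omega
  · intro e e' he he' h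
    simp only [Fin.forall_fin_succ, Matrix.cons_val_zero, Matrix.cons_val_succ, vec_le_iff] at he he'
    refine normal_eq_of_weight_eq_right (t := t) (p := p) (n := n) hco (by omega) htp
      (by omega) (by omega) (by omega) (by omega) (by omega) (by omega) (by omega) (by omega)
      (by omega) ?_
    refine Nat.eq_of_mul_eq_mul_left hd ?_
    simp only [Fin.sum_univ_four, translatedSeq, Matrix.cons_val] at h ⊢
    linear_combination h

/-- Generators, the `i`-th of which restricts to `xᵢ ^ αᵢ` on the `i`-th axis and to zero
on the others, are critical and form a minimal generating set. -/
lemma critical_and_minGenerators_of_toAxis {m : ℕ} (s : Fin m → ℕ) (hs : ∀ i, 0 < s i)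
    (f : Fin m → MvPolynomial (Fin m) k) (hP : definingIdeal k s = Ideal.span (Set.range f))
    (α : Fin m → ℕ) (e : Fin m → Fin m → ℕ) (hα : ∀ i, 0 < α i)
    (hf : ∀ i, f i = X i ^ α i - ∏ l ∈ Finset.univ.erase i, X l ^ e i l)
    (h : ∀ i l, toAxis k i (f l) = if l = i then Polynomial.X ^ α i else 0) :
    (∀ i, IsCriticalBinomial k s i (f i)) ∧ definingIdeal k s = Ideal.span (Set.range f) ∧
      minGenerators (definingIdeal k s) = m := by
  refine ⟨fun i => ?_, hP, ?_⟩
  · refine isCriticalBinomial_of_toAxis s i (hs i) f hP (α i) (hα i) (fun l => ?_) i (e i) (hf i)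
    rw [h]
    split_ifs <;> simp
  · rw [hP, minGenerators_span_range f id α 1 (by simp) (by simpa using h), Fintype.card_fin]

lemma translatedSeq_pos {a b c j : ℕ} (hj : 0 < j) (i : Fin 4) : 0 < translatedSeq a b c j i := by
  fin_cases i <;> simp [translatedSeq] <;> omega

lemma erase_zero : (Finset.univ : Finset (Fin 4)).erase 0 = {1, 2, 3} := by decide
lemma erase_one : (Finset.univ : Finset (Fin 4)).erase 1 = {0, 2, 3} := by decide
lemma erase_two : (Finset.univ : Finset (Fin 4)).erase 2 = {0, 1, 3} := by decide
lemma erase_three : (Finset.univ : Finset (Fin 4)).erase 3 = {0, 1, 2} := by decide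

lemma range_three {α : Type*} (x y z : α) : Set.range ![x, y, z] = {x, y, z} := by
  simp only [Matrix.range_cons, Matrix.range_empty, Set.union_empty, Set.singleton_union]

/-! ### The statements of the theorem, case by case -/

theorem definingIdeal_and_minGenerators_left_multiple {a b c p n j : ℕ}
    (ha : 0 < a) (hb : 0 < b) (hc : 0 < c) (hj : 1 ≤ j) :
    c = p * (a + b) → j = (a + b + c) * n →
      definingIdeal k (translatedSeq a b c j) =
          Ideal.span {X 0 ^ (n + 1) - X 3 ^ n,
            X 2 ^ (p + 1) - X 0 ^ p * X 3,
            X 1 ^ ((a + b) / a.gcd b) - X 0 ^ (b / a.gcd b) * X 2 ^ (a / a.gcd b)} ∧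
        minGenerators (definingIdeal k (translatedSeq a b c j)) = 3 := by
  intro hcp hjn
  have hp : 0 < p := Nat.pos_of_ne_zero (by rintro rfl; simp at hcp; omega)
  have hn : 0 < n := Nat.pos_of_ne_zero (by rintro rfl; simp at hjn; omega)
  obtain ⟨A, B, d, hA, hB, hd, hco, haA, hbB, e1, e2, e3⟩ := exists_coprime_parts ha hb
  rw [e1, e2, e3]
  subst haA hbB hcp hjn
  rw [definingIdeal_left_multiple hB hd hco hp hn]
  refine ⟨by rw [range_three], ?_⟩
  -- The first generator has pure powers on two axes; it is tested on that of `X 3`, whence the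
  -- coefficient -1.
  rw [minGenerators_span_range _ ![3, 2, 1] ![n, p + 1, A + B] ![-1, 1, 1] ?_ ?_,
    Fintype.card_fin]
  · intro i
    fin_cases i <;> simp
  · intro i l
    fin_cases i <;> fin_cases l <;>
      simp [toAxis_X, hA.ne', hB.ne', hp.ne', hn.ne']

theorem definingIdeal_and_minGenerators_right_multiple {a b c p n j : ℕ}
    (hb : 0 < b) (hc : 0 < c) (ha : 0 < a) (hj : 1 ≤ j) :
    a = p * (b + c) → j = (a + b + c) * n →
      definingIdeal k (translatedSeq a b c j) =
          Ideal.span {X 0 ^ (n + 1) - X 3 ^ n,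
            X 1 ^ (p + 1) - X 0 * X 3 ^ p,
            X 2 ^ ((b + c) / b.gcd c) - X 1 ^ (c / b.gcd c) * X 3 ^ (b / b.gcd c)} ∧
        minGenerators (definingIdeal k (translatedSeq a b c j)) = 3 := by
  intro hap hjn
  have hp : 0 < p := Nat.pos_of_ne_zero (by rintro rfl; simp at hap; omega)
  have hn : 0 < n := Nat.pos_of_ne_zero (by rintro rfl; simp at hjn; omega)
  obtain ⟨B, C, d, hB, hC, hd, hco, hbB, hcC, e1, e2, e3⟩ := exists_coprime_parts hb hc
  rw [e1, e2, e3]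
  subst hbB hcC hap hjn
  rw [definingIdeal_right_multiple hB hC hd hco hp hn]
  refine ⟨by rw [range_three], ?_⟩
  rw [minGenerators_span_range _ ![3, 1, 2] ![n, p + 1, B + C] ![-1, 1, 1] ?_ ?_,
    Fintype.card_fin]
  · intro i
    fin_cases i <;> simp
  · intro i l
    fin_cases i <;> fin_cases l <;>
      simp [toAxis_X, hC.ne', hB.ne', hp.ne', hn.ne']

theorem critical_generators_left_shift {a b c p n t j : ℕ}
    (ha : 0 < a) (hb : 0 < b) (hj : 1 ≤ j) :
    c = p * (a + b) → 1 ≤ t → t ≤ p → 1 ≤ n → p ≤ n + t →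
      j = (a + b + c) * n + (a + b) * t →
      ∃ f : Fin 4 → MvPolynomial (Fin 4) k,
        f = ![X 0 ^ (n + t + 1) - X 2 ^ t * X 3 ^ n,
          X 1 ^ ((a + b) / a.gcd b) - X 0 ^ (b / a.gcd b) * X 2 ^ (a / a.gcd b),
          X 2 ^ (p + 1) - X 0 ^ p * X 3,
          X 3 ^ (n + 1) - X 0 ^ (n + t - p + 1) * X 2 ^ (p - t + 1)] ∧
        (∀ i, IsCriticalBinomial k (translatedSeq a b c j) i (f i)) ∧
        definingIdeal k (translatedSeq a b c j) = Ideal.span (Set.range f) ∧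
        minGenerators (definingIdeal k (translatedSeq a b c j)) = 4 := by
  intro hcp ht htp hn hpn hjn
  have hp : 0 < p := by omega
  obtain ⟨A, B, d, hA, hB, hd, hco, haA, hbB, e1, e2, e3⟩ := exists_coprime_parts ha hb
  rw [e1, e2, e3]
  subst haA hbB hcp hjn
  refine ⟨_, rfl, ?_⟩
  refine critical_and_minGenerators_of_toAxis _ (translatedSeq_pos hj) _
    (definingIdeal_left_shift hB hd hco hp hn ht htp hpn)
    ![n + t + 1, A + B, p + 1, n + 1]
    ![![0, 0, t, n], ![B, 0, A, 0], ![p, 0, 0, 1], ![n + t - p + 1, 0, p - t + 1, 0]]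
    ?_ ?_ ?_
  · intro i
    fin_cases i <;> simp
    omega
  · intro i
    fin_cases i <;> simp [erase_zero, erase_one, erase_two, erase_three]
  · have ht0 : t ≠ 0 := by omega
    intro i l
    fin_cases i <;> fin_cases l <;>
      simp [toAxis_X, hA.ne', hB.ne', hp.ne', (Nat.lt_of_lt_of_le Nat.one_pos hn).ne', ht0]

theorem critical_generators_right_shift {a b c p n t j : ℕ}
    (hb : 0 < b) (hc : 0 < c) (hj : 1 ≤ j) :
    a = p * (b + c) → 1 ≤ t → t ≤ p → p < n + t →
      j = (a + b + c) * n + (b + c) * t →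
      ∃ f : Fin 4 → MvPolynomial (Fin 4) k,
        f = ![X 0 ^ (n + 2) - X 1 ^ (p + 1 - t) * X 3 ^ (n + t - p),
          X 1 ^ (p + 1) - X 0 * X 3 ^ p,
          X 2 ^ ((b + c) / b.gcd c) - X 1 ^ (c / b.gcd c) * X 3 ^ (b / b.gcd c),
          X 3 ^ (n + t) - X 0 ^ (n + 1) * X 1 ^ t] ∧
        (∀ i, IsCriticalBinomial k (translatedSeq a b c j) i (f i)) ∧
        definingIdeal k (translatedSeq a b c j) = Ideal.span (Set.range f) ∧
        minGenerators (definingIdeal k (translatedSeq a b c j)) = 4 := by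
  intro hap ht htp hpn hjn
  have hp : 0 < p := by omega
  obtain ⟨B, C, d, hB, hC, hd, hco, hbB, hcC, e1, e2, e3⟩ := exists_coprime_parts hb hc
  rw [e1, e2, e3]
  subst hbB hcC hap hjn
  refine ⟨_, rfl, ?_⟩
  refine critical_and_minGenerators_of_toAxis _ (translatedSeq_pos hj) _
    (definingIdeal_right_shift hB hC hd hco ht htp hpn)
    ![n + 2, p + 1, B + C, n + t]
    ![![0, p + 1 - t, 0, n + t - p], ![1, 0, 0, p], ![0, C, 0, B], ![n + 1, t, 0, 0]]
    ?_ ?_ ?_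
  · intro i
    fin_cases i <;> simp <;> omega
  · intro i
    fin_cases i <;> simp [erase_zero, erase_one, erase_two, erase_three]
  · have ht0 : t ≠ 0 := by omega
    have h1 : p + 1 - t ≠ 0 := by omega
    have h2 : n + t - p ≠ 0 := by omega
    intro i l
    fin_cases i <;> fin_cases l <;>
      simp [toAxis_X, hB.ne', hC.ne', hp.ne', ht0, h1, h2]

end Curves

theorem theoremA (k : Type*) [Field k] [CharZero k] (a b c p n t j : ℕ)
    (ha : 0 < a) (hb : 0 < b) (hc : 0 < c) (hj : 1 ≤ j) :
    -- `c = p (a + b)`, `j` a multiple of the period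
    (c = p * (a + b) → j = (a + b + c) * n →
      definingIdeal k (translatedSeq a b c j) =
          Ideal.span {X 0 ^ (n + 1) - X 3 ^ n,
            X 2 ^ (p + 1) - X 0 ^ p * X 3,
            X 1 ^ ((a + b) / a.gcd b) - X 0 ^ (b / a.gcd b) * X 2 ^ (a / a.gcd b)} ∧
        minGenerators (definingIdeal k (translatedSeq a b c j)) = 3) ∧
    -- `a = p (b + c)`, `j` a multiple of the period
    (a = p * (b + c) → j = (a + b + c) * n →
      definingIdeal k (translatedSeq a b c j) =
          Ideal.span {X 0 ^ (n + 1) - X 3 ^ n,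
            X 1 ^ (p + 1) - X 0 * X 3 ^ p,
            X 2 ^ ((b + c) / b.gcd c) - X 1 ^ (c / b.gcd c) * X 3 ^ (b / b.gcd c)} ∧
        minGenerators (definingIdeal k (translatedSeq a b c j)) = 3) ∧
    -- `c = p (a + b)`, `j` shifted by `(a + b) t`
    (c = p * (a + b) → 1 ≤ t → t ≤ p → 1 ≤ n → p ≤ n + t →
      j = (a + b + c) * n + (a + b) * t →
      ∃ f : Fin 4 → MvPolynomial (Fin 4) k,
        f = ![X 0 ^ (n + t + 1) - X 2 ^ t * X 3 ^ n,
          X 1 ^ ((a + b) / a.gcd b) - X 0 ^ (b / a.gcd b) * X 2 ^ (a / a.gcd b),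
          X 2 ^ (p + 1) - X 0 ^ p * X 3,
          X 3 ^ (n + 1) - X 0 ^ (n + t - p + 1) * X 2 ^ (p - t + 1)] ∧
        (∀ i, IsCriticalBinomial k (translatedSeq a b c j) i (f i)) ∧
        definingIdeal k (translatedSeq a b c j) = Ideal.span (Set.range f) ∧
        minGenerators (definingIdeal k (translatedSeq a b c j)) = 4) ∧
    -- `a = p (b + c)`, `j` shifted by `(b + c) t`
    (a = p * (b + c) → 1 ≤ t → t ≤ p → p < n + t →
      j = (a + b + c) * n + (b + c) * t →
      ∃ f : Fin 4 → MvPolynomial (Fin 4) k,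
        f = ![X 0 ^ (n + 2) - X 1 ^ (p + 1 - t) * X 3 ^ (n + t - p),
          X 1 ^ (p + 1) - X 0 * X 3 ^ p,
          X 2 ^ ((b + c) / b.gcd c) - X 1 ^ (c / b.gcd c) * X 3 ^ (b / b.gcd c),
          X 3 ^ (n + t) - X 0 ^ (n + 1) * X 1 ^ t] ∧
        (∀ i, IsCriticalBinomial k (translatedSeq a b c j) i (f i)) ∧
        definingIdeal k (translatedSeq a b c j) = Ideal.span (Set.range f) ∧
        minGenerators (definingIdeal k (translatedSeq a b c j)) = 4) := by
  exact ⟨definingIdeal_and_minGenerators_left_multiple ha hb hc hj,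
    definingIdeal_and_minGenerators_right_multiple hb hc ha hj,
    critical_generators_left_shift ha hb hj, critical_generators_right_shift hb hc hj⟩
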